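/- Let $V$ be a set of $n\ge 4$ agents, and let $K\ge 2$ and $M\ge n$ be real constants. A strategy of an agent $u$ is a finite set $S_u\subseteq V\times\mathbb Z$, where $(v,l)\in S_u$ means that $u$ buys the edge $\{u,v\}$ with label $l$. A strategy profile $\mathbf s=(S_u)_{u\in V}$ forms the temporal graph $G(\mathbf s)$ on $V$ whose edges are the bought edges $\{u,v\}$, $u\neq v$, where the label of an edge is the smallest label bought for it by either endpoint. Agent $u$ reaches $v$ if there is a (possibly empty) path from $u$ to $v$ in $G(\mathbf s)$ with strictly increasing labels; let $R_{\mathbf s}(u)$ be the set of agents reached by $u$. With uniform label cost (labels are free) and positive labels enforced by a penalty, the cost of $u$ is $$c(u,\mathbf s)=|S_u|+M\cdot|\{(v,l)\in S_u: l<1\}|+K\cdot|V\setminus R_{\mathbf s}(u)|,$$ and the social cost is $C(\mathbf s)=\sum_{u\in V}c(u,\mathbf s)$. A profile is a Nash equilibrium if no agent can strictly lower its own cost by changing only its own strategy. The price of stability (PoS) is the minimal social cost of a Nash equilibrium divided by the minimal social cost of any profile. **Theorem.** (i) There is a Nash equilibrium $\mathbf s$ such that every agent reaches every agent, $G(\mathbf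 s)$ has exactly $2n-4$ edges, $C(\mathbf s)=2n-4$, and $\mathbf s$ is a labeled 4-cycle plus two edges per remaining agent. The latter means: there are distinct agents $a,b,c,d$ such that $a$ buys $\{a,b\}$ with label $n$, $b$ buys $\{b,c\}$ with label $n+1$, $c$ buys $\{c,d\}$ with label $n$, and $d$ buys $\{d,a\}$ with label $n+1$; for each remaining agent $v$ there is an ordering $(x,y)$ of the pair $a,c$ such that $v$ buys $\{v,x\}$ with a label in $\{1,\dots,n-1\}$ and $y$ buys $\{y,v\}$ with a label greater than $n+1$; nothing else is bought. (ii) The minimal social cost over all profiles is attained and equals $2n-4$. (iii) $\mathrm{PoS}=1$. -/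

import Mathlib

/-- An undirected graph on `V` with an integer time label on every edge
(the value of `label` at a pair that is not an edge is irrelevant). -/
structure TemporalGraph (V : Type*) where
  graph : SimpleGraph V
  label : Sym2 V → ℤ

namespace TemporalGraph

/-- The vertices reachable from `v` by a temporal path whose consecutive labels are related by `r`
(`r` is `<` for strict reachability and `≤` for non-strict reachability). The empty path is
allowed, so `v` itself is always reachable. -/
def reach {V : Type*} (r : ℤ → ℤ → Prop) (G : TemporalGraph V) (v : V) : Set V :=
  {w | ∃ p : G.graph.Walk v w, (p.edges.map G.label).IsChain r}

/-- Every vertex reaches every vertex. -/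
def TemporallyConnected {V : Type*} (r : ℤ → ℤ → Prop) (G : TemporalGraph V) : Prop :=
  ∀ v, G.reach r v = Set.univ

end TemporalGraph

namespace CreationGame

/-- A strategy: a finite set of pairs `(v, l)`, "buy an edge towards `v` with label `l`". -/
abbrev Strategy (V : Type*) := Finset (V × ℤ)

/-- A strategy for every agent. -/
abbrev Profile (V : Type*) := V → Strategy V

/-- The temporal graph formed by a strategy profile: all bought edges, each with the minimal label
bought for it by either endpoint. -/
noncomputable def formed {V : Type*} (s : Profile V) : TemporalGraph V where
  graph := SimpleGraph.fromRel fun u v => ∃ l, (v, l) ∈ s u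
  label e := sInf {l : ℤ | ∃ u v, e = s(u, v) ∧ (v, l) ∈ s u}

/-- The cost of agent `u`: number of bought edges, plus label costs `f`, plus penalty `P`, plus `K`
for every agent that `u` does not reach. -/
noncomputable def cost {V : Type*} (r : ℤ → ℤ → Prop) (f : Profile V → Sym2 V → ℝ)
    (P : Profile V → V → ℝ) (K : ℝ) (s : Profile V) (u : V) : ℝ :=
  ((s u).card : ℝ) + ∑ p ∈ s u, f s s(u, p.1) + P s u
    + K * (((formed s).reach r u)ᶜ.ncard : ℝ)

/-- The uniform label cost: every label is free. -/
def uniformLabelCost {V : Type*} : Profile V → Sym2 V → ℝ := fun _ _ => 0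

/-- The penalty `M` for every bought edge whose label is smaller than `1`. -/
def positivePenalty {V : Type*} (M : ℝ) : Profile V → V → ℝ :=
  fun s u => M * (((s u).filter fun p => p.2 < 1).card : ℝ)

/-- The agents' cost in the strict, uniform label cost, positive label variant. -/
noncomputable def strictUniformCost {V : Type*} (K M : ℝ) (s : Profile V) (u : V) : ℝ :=
  cost (· < ·) uniformLabelCost (positivePenalty M) K s u

/-- No agent can strictly lower its own cost by changing only its own strategy. -/
def IsNash {V : Type*} [DecidableEq V] (c : Profile V → V → ℝ) (s : Profile V) : Prop :=
  ∀ (v : V) (S : Strategy V), ¬ c (Function.update s v S) v < c s v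

/-- The sum of the costs of all agents. -/
def socialCost {V : Type*} [Fintype V] (c : Profile V → V → ℝ) (s : Profile V) : ℝ :=
  ∑ v, c s v

/-- The minimal social cost of a Nash equilibrium divided by the minimal social cost. -/
noncomputable def priceOfStability {V : Type*} [Fintype V] [DecidableEq V]
    (c : Profile V → V → ℝ) : ℝ :=
  sInf (socialCost c '' {s | IsNash c s}) / sInf (Set.range (socialCost c))

/-- A labeled 4-cycle plus two edges per remaining vertex. With `n` agents:
`a, b, c, d` each buy the next edge of a 4-cycle, with labels `n, n + 1, n, n + 1`; the remaining
agents are split into `A` and `C`; each `v` in `A` buys an edge to `a` with a label `lo v` below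
`n`, and `c` buys an edge to `v` with a label `hi v` above `n + 1`; each `v` in `C` likewise with
the roles of `a` and `c` exchanged. Nothing else is bought. -/
def IsRingProfile {V : Type*} [Fintype V] [DecidableEq V] (s : Profile V) : Prop :=
  ∃ (a b c d : V) (A C : Finset V) (lo hi : V → ℤ),
    [a, b, c, d].Nodup ∧ Disjoint A C ∧ A ∪ C = ({a, b, c, d} : Finset V)ᶜ ∧
    (∀ v ∈ A ∪ C, 1 ≤ lo v ∧ lo v < Fintype.card V ∧ (Fintype.card V : ℤ) + 1 < hi v) ∧
    s a = insert (b, (Fintype.card V : ℤ)) (C.image fun v => (v, hi v)) ∧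
    s b = {(c, (Fintype.card V : ℤ) + 1)} ∧
    s c = insert (d, (Fintype.card V : ℤ)) (A.image fun v => (v, hi v)) ∧
    s d = {(a, (Fintype.card V : ℤ) + 1)} ∧
    (∀ v ∈ A, s v = {(a, lo v)}) ∧ (∀ v ∈ C, s v = {(c, lo v)})

end CreationGame

/-! The lower bound is the gossip theorem: complete exchange of information among `n` people takes
at least `2n - 4` calls (`Complete.two_mul_card_le`). Sorting the edges of a temporal graph by label
gives a call sequence. Appending one call for every ordered pair without a temporal path makes it
complete, so edges plus unreached pairs number at least `2n - 4` (`TemporalGraph.two_mul_card_le`).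
Each bought edge costs 1 and each unreached pair costs `K ≥ 1`, which bounds the social cost of
every profile.

The gossip theorem goes by induction on `n`. If some `x` hears their own information, a token leaves
`x` and returns; letting the token's holder act for `x` removes one person and two calls
(`exists_removal`). If nobody does (`card_le_of_noEcho`), suppose there are at most `2n - 5` calls.
Then everyone has at least three calls, and a first or last call of one end is first or last for
both ends. So at least `n/2` calls are first, at least `n/2` others are last, and at most `n - 5`
remain. Some `x` has at most three calls; counting shows that every call spreads information from
`x` or towards `x`. Hence the remaining calls and the first and last call of `x` connect all people,
with at most `n - 3` edges, which is impossible.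

The bound is attained by `ringProfile`, which is connected and pays only for its `2n - 4` edges. It
is an equilibrium: an agent other than `c` pays 1 and loses someone by buying nothing, while `c`
needs one edge for each agent outside the cycle and one more to reach `a`. -/

namespace Gossip

/-! ### Call sequences, tokens and time reversal -/

/-- Starting at `u` at time `i`, a token can be at `v` at time `j` when the call `f k` lets it cross
between its two ends at time `k`. A diagonal value of `f` stands for no call. -/
def Reaches {V : Type*} (f : ℕ → Sym2 V) (i j : ℕ) (u v : V) : Prop :=
  ∃ φ : ℕ → V, φ i = u ∧ φ j = v ∧
    ∀ k, i ≤ k → k < j → φ (k + 1) = φ k ∨ f k = s(φ k, φ (k + 1))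

/-- Everyone's information reaches everyone before time `m`. -/
def Complete {V : Type*} (f : ℕ → Sym2 V) (m : ℕ) : Prop := ∀ u v, Reaches f 0 m u v

/-- Nobody hears their own information. -/
def NoEcho {V : Type*} (f : ℕ → Sym2 V) (m : ℕ) : Prop :=
  ∀ x u, ∀ i ≤ m, Reaches f 0 i x u → Reaches f i m u x → u = x

open Classical in
/-- The times before `m` at which there is a call. -/
noncomputable def calls {V : Type*} (f : ℕ → Sym2 V) (m : ℕ) : Finset ℕ :=
  (Finset.range m).filter fun i => ¬ (f i).IsDiag

/-- The calls before time `m` in reverse order. -/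
def rev {V : Type*} (f : ℕ → Sym2 V) (m : ℕ) : ℕ → Sym2 V := fun i => f (m - 1 - i)

/-- The call at time `i` is the first one for both of its ends. -/
def IsFirst {V : Type*} (f : ℕ → Sym2 V) (m i : ℕ) : Prop :=
  ∀ v ∈ f i, ∀ k ∈ calls f m, v ∈ f k → i ≤ k

/-- The call at time `i` is the last one for both of its ends. -/
def IsLast {V : Type*} (f : ℕ → Sym2 V) (m i : ℕ) : Prop :=
  ∀ v ∈ f i, ∀ k ∈ calls f m, v ∈ f k → k ≤ i

variable {V : Type*} {f : ℕ → Sym2 V} {m i j k : ℕ} {u v w x y : V}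

theorem mem_calls : i ∈ calls f m ↔ i < m ∧ ¬ (f i).IsDiag := by
  simp [calls]

theorem Reaches.trans (hij : i ≤ j) (hjk : j ≤ k) (h : Reaches f i j u v) (h' : Reaches f j k v w) :
    Reaches f i k u w := by
  obtain ⟨φ, hi, hj, hφ⟩ := h
  obtain ⟨ψ, hj', hk, hψ⟩ := h'
  refine ⟨fun t => if t ≤ j then φ t else ψ t, by simp [hij, hi], ?_, ?_⟩
  · by_cases h : k ≤ j
    · obtain rfl : j = k := le_antisymm hjk h
      simp [hj, ← hk, hj']
    · simp [h, hk]
  · intro t h1 h2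
    rcases lt_trichotomy t j with h | h | h
    · simpa [h.le, Nat.succ_le_of_lt h] using hφ t h1 h
    · subst h
      simpa [hj, ← hj'] using hψ t le_rfl h2
    · simpa [h.not_ge, (h.trans t.lt_succ_self).not_ge] using hψ t h.le h2

theorem Reaches.single (h : f i = s(u, v)) : Reaches f i (i + 1) u v := by
  refine ⟨fun t => if t ≤ i then u else v, by simp, by simp, ?_⟩
  intro t h1 h2
  obtain rfl : t = i := by omega
  simp [h]

theorem Reaches.stay (f : ℕ → Sym2 V) (i j : ℕ) (u : V) : Reaches f i j u u :=
  ⟨fun _ => u, rfl, rfl, fun _ _ _ => Or.inl rfl⟩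

theorem Reaches.exists_last (hij : i ≤ j)
    (h : Reaches f i (j + 1) u w) :
    ∃ v, Reaches f i j u v ∧ (w = v ∨ f j = s(v, w)) := by
  obtain ⟨φ, hi, hj, hφ⟩ := h
  refine ⟨φ j, ⟨φ, hi, rfl, fun k h1 h2 => hφ k h1 (by omega)⟩, ?_⟩
  simpa [hj] using hφ j hij (by omega)

/-- Call `k` acts between times `k` and `k + 1`, so times reflect as `m - t` but call indices as `m
- 1 - k`. -/
theorem Reaches.rev (hij : i ≤ j) (hj : j ≤ m) (h : Reaches f i j u v) :
    Reaches (rev f m) (m - j) (m - i) v u := by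
  obtain ⟨φ, hi, hj', hφ⟩ := h
  refine ⟨fun t => φ (m - t), by simp [Nat.sub_sub_self hj, hj'],
    by simp [Nat.sub_sub_self (hij.trans hj), hi], fun t h1 h2 => ?_⟩
  have := hφ (m - 1 - t) (by omega) (by omega)
  rw [show m - 1 - t + 1 = m - t by omega, show m - 1 - t = m - (t + 1) by omega] at this
  rcases this with h | h
  · exact Or.inl h.symm
  · right
    rw [Gossip.rev, show m - 1 - t = m - (t + 1) by omega, h, Sym2.eq_swap]

theorem Reaches.of_rev (hij : i ≤ j) (hj : j ≤ m)
    (h : Reaches (Gossip.rev f m) (m - j) (m - i) v u) : Reaches f i j u v := by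
  have := h.rev (m := m) (by omega) (by omega)
  rw [Nat.sub_sub_self hj, Nat.sub_sub_self (hij.trans hj)] at this
  obtain ⟨φ, h1, h2, h3⟩ := this
  refine ⟨φ, h1, h2, fun t ht ht' => ?_⟩
  have := h3 t ht ht'
  rwa [Gossip.rev, Gossip.rev, show m - 1 - (m - 1 - t) = t by omega] at this

theorem Complete.rev (h : Complete f m) : Complete (rev f m) m := fun u v => by
  simpa using (h v u).rev (Nat.zero_le _) le_rfl

theorem NoEcho.rev (h : NoEcho f m) : NoEcho (rev f m) m := by
  intro x u i hi h1 h2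
  refine h x u (m - i) (by omega) ?_ ?_
  · exact Reaches.of_rev (m := m) (Nat.zero_le _) (by omega) (by rwa [Nat.sub_sub_self hi, Nat.sub_zero])
  · exact Reaches.of_rev (m := m) (by omega) le_rfl (by rwa [Nat.sub_sub_self hi, Nat.sub_self])

theorem rev_apply_sub (hi : i < m) : rev f m (m - 1 - i) = f i := by
  rw [rev, show m - 1 - (m - 1 - i) = i by omega]

theorem sub_mem_calls_rev (hi : i ∈ calls f m) : m - 1 - i ∈ calls (rev f m) m := by
  rw [mem_calls] at *
  rw [rev_apply_sub hi.1]
  exact ⟨by omega, hi.2⟩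

theorem sub_mem_calls_of_rev (hi : i ∈ calls (rev f m) m) : m - 1 - i ∈ calls f m := by
  rw [mem_calls] at *
  exact ⟨by omega, hi.2⟩

theorem IsFirst.rev (h : IsFirst f m i) (hi : i ∈ calls f m) : IsLast (rev f m) m (m - 1 - i) := by
  intro v hv k hk hvk
  have hi' := (mem_calls.1 hi).1
  have hk' := (mem_calls.1 hk).1
  rw [rev_apply_sub hi'] at hv
  have := h v hv (m - 1 - k) (sub_mem_calls_of_rev hk) hvk
  omega

theorem IsLast.rev (h : IsLast f m i) (hi : i ∈ calls f m) : IsFirst (rev f m) m (m - 1 - i) := by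
  intro v hv k hk hvk
  have hi' := (mem_calls.1 hi).1
  have hk' := (mem_calls.1 hk).1
  rw [rev_apply_sub hi'] at hv
  have := h v hv (m - 1 - k) (sub_mem_calls_of_rev hk) hvk
  omega

theorem IsFirst.of_rev (hi : i ∈ calls f m) (h : IsFirst (Gossip.rev f m) m (m - 1 - i)) :
    IsLast f m i := by
  intro v hv k hk hvk
  have hi' := (mem_calls.1 hi).1
  have hk' := (mem_calls.1 hk).1
  have := h v (by rwa [rev_apply_sub hi']) (m - 1 - k) (sub_mem_calls_rev hk)
    (by rwa [rev_apply_sub hk'])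
  omega

theorem IsLast.of_rev (hi : i ∈ calls f m) (h : IsLast (Gossip.rev f m) m (m - 1 - i)) :
    IsFirst f m i := by
  intro v hv k hk hvk
  have hi' := (mem_calls.1 hi).1
  have hk' := (mem_calls.1 hk).1
  have := h v (by rwa [rev_apply_sub hi']) (m - 1 - k) (sub_mem_calls_rev hk)
    (by rwa [rev_apply_sub hk'])
  omega

/-! ### Calls that carry information from or to one person -/

/-- For each person other than `x`, the call in which they first learn the information of `x`. -/
theorem exists_informing_calls [Fintype V] (hf : Complete f m) (x : V) :
    ∃ O ⊆ calls f m, O.card + 1 = Fintype.card V ∧ ∀ i ∈ O, ∃ u ∈ f i, Reaches f 0 i x u := by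
  classical
  have key : ∀ v, v ≠ x → ∃ i < m, ¬ Reaches f 0 i x v ∧ ∃ u, Reaches f 0 i x u ∧ f i = s(u, v) := by
    intro v hv
    have hex : ∃ i, Reaches f 0 i x v := ⟨m, hf x v⟩
    have h0 : Nat.find hex ≠ 0 := by
      intro h
      have := Nat.find_spec hex
      rw [h] at this
      obtain ⟨φ, h1, h2, -⟩ := this
      exact hv (h2.symm.trans h1)
    obtain ⟨i, hi⟩ := Nat.exists_eq_succ_of_ne_zero h0
    have hlt : i < Nat.find hex := by omega
    have hnot := Nat.find_min hex hlt
    have hspec := Nat.find_spec hex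
    rw [hi] at hspec
    obtain ⟨u, hu, h⟩ := hspec.exists_last (Nat.zero_le _)
    have hm := Nat.find_min' hex (hf x v)
    refine ⟨i, by omega, hnot, u, hu, h.resolve_left ?_⟩
    rintro rfl
    exact hnot hu
  choose! o ho hno p hp hop using key
  refine ⟨(Finset.univ.erase x).image o, ?_, ?_, ?_⟩
  · intro i hi
    simp only [Finset.mem_image, Finset.mem_erase, Finset.mem_univ, and_true] at hi
    obtain ⟨v, hv, rfl⟩ := hi
    refine mem_calls.2 ⟨ho v hv, ?_⟩
    rw [hop v hv, Sym2.mk_isDiag_iff]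
    intro h
    have := hp v hv
    rw [h] at this
    exact hno v hv this
  · rw [Finset.card_image_of_injOn, Finset.card_erase_of_mem (Finset.mem_univ x)]
    · have : 0 < Fintype.card V := Fintype.card_pos_iff.2 ⟨x⟩
      rw [Finset.card_univ]
      omega
    -- A call that first informs one end has an already informed other end, so it cannot first
    -- inform both.
    · intro v hv w hw h
      simp only [Finset.coe_erase, Finset.coe_univ, Set.mem_sdiff, Set.mem_univ, true_and,
        Set.mem_singleton_iff] at hv hw
      have h1 := hop v hv
      rw [h, hop w hw, Sym2.eq_iff] at h1
      rcases h1 with h1 | h1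
      · exact h1.2.symm
      · have := hp w hw
        rw [← h, h1.1] at this
        exact absurd this (hno v hv)
  · intro i hi
    simp only [Finset.mem_image, Finset.mem_erase, Finset.mem_univ, and_true] at hi
    obtain ⟨v, hv, rfl⟩ := hi
    exact ⟨p v, by simp [hop v hv], hp v hv⟩

/-- For each person other than `x`, the last call through which their information reaches `x`. -/
theorem exists_departing_calls [Fintype V] (hf : Complete f m) (x : V) :
    ∃ I ⊆ calls f m, I.card + 1 = Fintype.card V ∧
      ∀ i ∈ I, ∃ u ∈ f i, Reaches f (i + 1) m u x := by
  classical
  obtain ⟨O, hO, hcard, h⟩ := exists_informing_calls hf.rev x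
  refine ⟨O.image fun i => m - 1 - i, ?_, ?_, ?_⟩
  · intro i hi
    obtain ⟨k, hk, rfl⟩ := Finset.mem_image.1 hi
    exact sub_mem_calls_of_rev (hO hk)
  · rw [Finset.card_image_of_injOn, hcard]
    intro a ha b hb hab
    have := (mem_calls.1 (hO ha)).1
    have := (mem_calls.1 (hO hb)).1
    simp only at hab
    omega
  · intro i hi
    obtain ⟨k, hk, rfl⟩ := Finset.mem_image.1 hi
    have := (mem_calls.1 (hO hk)).1
    obtain ⟨u, hu, hr⟩ := h k hk
    refine ⟨u, hu, Reaches.of_rev (by omega) le_rfl ?_⟩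
    rwa [Nat.sub_self, show m - (m - 1 - k + 1) = k by omega]

/-! ### First and last calls -/

/-- A token at an end of a call that is not reached by another call stays there. -/
theorem eq_of_no_calls {φ : ℕ → V} (hij : i ≤ j) (hj : j ≤ m)
    (hφ : ∀ k, i ≤ k → k < j → φ (k + 1) = φ k ∨ f k = s(φ k, φ (k + 1)))
    (hno : ∀ k ∈ calls f m, i ≤ k → k < j → φ i ∉ f k) : φ j = φ i := by
  induction j, hij using Nat.le_induction with
  | base => rfl
  | succ j hij ih =>
    have ih := ih (by omega) (fun k h1 h2 => hφ k h1 (by omega))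
      (fun k hk h1 h2 => hno k hk h1 (by omega))
    rcases hφ j hij (by omega) with h | h
    · rw [h, ih]
    · by_contra hne
      refine hno j (mem_calls.2 ⟨by omega, ?_⟩) hij (by omega) (by simp [h, ih])
      rw [h, Sym2.mk_isDiag_iff, ih]
      exact fun h => hne h.symm

theorem eq_of_no_calls' {φ : ℕ → V} (hij : i ≤ j) (hj : j ≤ m)
    (hφ : ∀ k, i ≤ k → k < j → φ (k + 1) = φ k ∨ f k = s(φ k, φ (k + 1)))
    (hno : ∀ k ∈ calls f m, i ≤ k → k < j → φ j ∉ f k) : φ i = φ j := by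
  obtain ⟨d, rfl⟩ := Nat.exists_eq_add_of_le hij
  induction d generalizing i with
  | zero => rfl
  | succ d ih =>
    rw [show i + (d + 1) = i + 1 + d by omega] at *
    have ih := ih (by omega) hj (fun k h1 h2 => hφ k (by omega) h2)
      (fun k hk h1 h2 => hno k hk (by omega) h2)
    rcases hφ i le_rfl (by omega) with h | h
    · rw [← h, ih]
    · by_contra hne
      refine hno i (mem_calls.2 ⟨by omega, ?_⟩) le_rfl (by omega) (by simp [h, ih])
      rw [h, Sym2.mk_isDiag_iff, ih]
      exact hne

/-- After call `i` both ends know everything that `x` will ever know, hence everything. If the other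
end later called some `z`, then `z` would hear their own information. -/
theorem isLast_of_last (hf : Complete f m) (he : NoEcho f m) (hx : x ∈ f i)
    (hlast : ∀ k ∈ calls f m, x ∈ f k → k ≤ i) : IsLast f m i := by
  intro y hy j hj hyj
  by_contra! hlt
  obtain ⟨z, hz⟩ := Sym2.mem_iff_exists.1 hyj
  have hjm := (mem_calls.1 hj).1
  have hne : y ≠ z := by
    have := (mem_calls.1 hj).2
    rwa [hz, Sym2.mk_isDiag_iff] at this
  obtain ⟨φ, h0, hm, hφ⟩ := hf z x
  have hstay : φ (i + 1) = x := by
    rw [← hm]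
    refine eq_of_no_calls' (f := f) (m := m) (by omega) le_rfl
      (fun k h1 h2 => hφ k (by omega) h2) ?_
    intro k hk h1 h2 hmem
    have := hlast k hk (hm ▸ hmem)
    omega
  have hzx : Reaches f 0 (i + 1) z x := ⟨φ, h0, hstay, fun k h1 h2 => hφ k h1 (by omega)⟩
  have hzy : Reaches f 0 (i + 1) z y := by
    by_cases hxy : x = y
    · exact hxy ▸ hzx
    have hfi : f i = s(x, y) := (Sym2.mem_and_mem_iff hxy).1 ⟨hx, hy⟩
    obtain ⟨v, hv, h⟩ := hzx.exists_last (Nat.zero_le _)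
    rcases h with h | h
    · exact hv.trans (Nat.zero_le _) (Nat.le_succ _) (h ▸ Reaches.single hfi)
    · rw [hfi, Sym2.eq_iff] at h
      rcases h with h | h
      · exact absurd h.2.symm hxy
      · exact hv.trans (Nat.zero_le _) (Nat.le_succ _) (h.2 ▸ Reaches.stay _ _ _ _)
  exact hne (he z y j hjm.le
    (hzy.trans (Nat.zero_le _) (by omega) (Reaches.stay _ _ _ _))
    ((Reaches.single hz).trans (Nat.le_succ _) (by omega) (Reaches.stay _ _ _ _)))

theorem isFirst_of_first (hf : Complete f m) (he : NoEcho f m) (hi : i ∈ calls f m)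
    (hx : x ∈ f i)
    (hfirst : ∀ k ∈ calls f m, x ∈ f k → i ≤ k) : IsFirst f m i := by
  have hi' := (mem_calls.1 hi).1
  refine IsLast.of_rev hi (isLast_of_last hf.rev he.rev
    (x := x) (by rwa [rev_apply_sub hi']) ?_)
  intro k hk hxk
  have := (mem_calls.1 hk).1
  have := hfirst (m - 1 - k) (sub_mem_calls_of_rev hk) hxk
  omega

/-- Before the last call of its holder, information from `x` has crossed only the first call of `x`
and calls that are neither first nor last. -/
theorem reachable_of_reaches {H : SimpleGraph V}
    (hmid : ∀ j ∈ calls f m, ¬ IsFirst f m j → ¬ IsLast f m j →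
      ∀ p q, f j = s(p, q) → H.Reachable p q)
    (hfirst : ∀ j ∈ calls f m, IsFirst f m j → ∀ q, f j = s(x, q) → H.Reachable x q)
    (hi : i ∈ calls f m) (hu : u ∈ f i) (h : Reaches f 0 i x u) : H.Reachable x u := by
  obtain ⟨φ, h0, hi', hφ⟩ := h
  have him := (mem_calls.1 hi).1
  have key : ∀ j ≤ i, H.Reachable x (φ j) := by
    intro j
    induction j with
    | zero => rw [h0]; intro; rfl
    | succ j ih =>
      intro hj
      have ih := ih (by omega)
      rcases hφ j (Nat.zero_le _) (by omega) with h | h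
      · rwa [h]
      by_cases hne : φ (j + 1) = φ j
      · rwa [hne]
      have hjc : j ∈ calls f m := mem_calls.2 ⟨by omega, by
        rw [h, Sym2.mk_isDiag_iff]; exact fun h => hne h.symm⟩
      by_cases hF : IsFirst f m j
      -- The holder has had no earlier call, so the token is still at `x`.
      · have : φ 0 = φ j := by
          refine eq_of_no_calls' (f := f) (m := m) (Nat.zero_le _) (by omega)
            (fun k h1 h2 => hφ k h1 (by omega)) ?_
          intro k hk h1 h2 hmem
          have := hF (φ j) (by simp [h]) k hk hmem
          omega
        exact hfirst j hjc hF _ (by rw [h, ← this, h0])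
      by_cases hL : IsLast f m j
      -- After a last call the token is stuck with someone who has no further call, yet its holder
      -- takes part in call `i > j`.
      · have : φ i = φ (j + 1) := by
          refine eq_of_no_calls (f := f) (m := m) hj him.le
            (fun k h1 h2 => hφ k (by omega) h2) ?_
          intro k hk h1 h2 hmem
          have := hL (φ (j + 1)) (by simp [h]) k hk hmem
          omega
        have := hL (φ (j + 1)) (by simp [h]) i hi (by rwa [← this, hi'])
        omega
      exact ih.trans (hmid j hjc hF hL _ _ h)
  exact hi' ▸ key i le_rfl

theorem reachable_of_reaches' {H : SimpleGraph V}
    (hmid : ∀ j ∈ calls f m, ¬ IsFirst f m j → ¬ IsLast f m j →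
      ∀ p q, f j = s(p, q) → H.Reachable p q)
    (hlast : ∀ j ∈ calls f m, IsLast f m j → ∀ q, f j = s(x, q) → H.Reachable x q)
    (hi : i ∈ calls f m) (hu : u ∈ f i) (h : Reaches f (i + 1) m u x) : H.Reachable x u := by
  have him := (mem_calls.1 hi).1
  refine reachable_of_reaches (f := rev f m) (m := m) (i := m - 1 - i) ?_ ?_
    (sub_mem_calls_rev hi) (by rwa [rev_apply_sub him]) ?_
  · intro j hj hF hL p q hpq
    refine hmid _ (sub_mem_calls_of_rev hj) (fun h => hL ?_) (fun h => hF ?_) p q hpq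
    · have := h.rev (sub_mem_calls_of_rev hj)
      rwa [show m - 1 - (m - 1 - j) = j by have := (mem_calls.1 hj).1; omega] at this
    · have := h.rev (sub_mem_calls_of_rev hj)
      rwa [show m - 1 - (m - 1 - j) = j by have := (mem_calls.1 hj).1; omega] at this
  · intro j hj hF q hq
    refine hlast _ (sub_mem_calls_of_rev hj) (IsFirst.of_rev (sub_mem_calls_of_rev hj) ?_) q hq
    rwa [show m - 1 - (m - 1 - j) = j by have := (mem_calls.1 hj).1; omega]
  · have := h.rev (m := m) (by omega) le_rfl
    rwa [Nat.sub_self, show m - (i + 1) = m - 1 - i by omega] at this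

/-! ### Removing a person who hears their own information -/

/-- If `x` hears their own information, then there is a token that is never at `x`, but meets `x`
in two different calls. -/
theorem exists_excursion (h : ¬ NoEcho f m) : ∃ (x : V) (ψ : ℕ → V) (t₁ t₂ : ℕ),
    (∀ t, ψ t ≠ x) ∧ (∀ t < m, ψ (t + 1) = ψ t ∨ f t = s(ψ t, ψ (t + 1))) ∧
    t₁ < t₂ ∧ t₂ < m ∧ f t₁ = s(x, ψ t₁) ∧ f t₂ = s(x, ψ t₂) := by
  classical
  unfold NoEcho at h
  push Not at h
  obtain ⟨x, u, i, him, ⟨φ, h0, hi, hφ⟩, ⟨χ, hi', hm, hχ⟩, hux⟩ := h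
  -- Cut the round trip down to the last departure from `x` before time `i` and the first return
  -- after it.
  have ex1 : ∃ t₁ < i, φ t₁ = x ∧ ∀ t, t₁ < t → t ≤ i → φ t ≠ x := by
    have hs := Nat.findGreatest_spec (P := fun t => φ t = x) (Nat.zero_le i) h0
    refine ⟨_, lt_of_le_of_ne (Nat.findGreatest_le i) ?_, hs, fun t ht hti h =>
      (Nat.findGreatest_is_greatest ht hti) h⟩
    intro h
    rw [h] at hs
    exact hux (hi.symm.trans hs)
  have ex2 : ∃ t₂, i ≤ t₂ ∧ t₂ < m ∧ χ (t₂ + 1) = x ∧ ∀ t, i ≤ t → t ≤ t₂ → χ t ≠ x := by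
    have hex : ∃ t, i ≤ t ∧ χ t = x := ⟨m, him, hm⟩
    have hspec := Nat.find_spec hex
    have hmin := fun t (ht : t < Nat.find hex) => Nat.find_min hex ht
    have hle := Nat.find_min' hex ⟨him, hm⟩
    generalize Nat.find hex = k at *
    have : k ≠ i := by
      rintro rfl
      exact hux (hi'.symm.trans hspec.2)
    refine ⟨k - 1, by omega, by omega, ?_, fun t h1 h2 h => hmin t (by omega) ⟨h1, h⟩⟩
    rw [Nat.sub_add_cancel (by omega)]
    exact hspec.2
  obtain ⟨t₁, ht₁, hx₁, hne₁⟩ := ex1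
  obtain ⟨t₂, ht₂, ht₂m, hx₂, hne₂⟩ := ex2
  refine ⟨x, fun t => if t ≤ i then φ (max t (t₁ + 1)) else χ (min t t₂), t₁, t₂, ?_, ?_,
    by omega, ht₂m, ?_, ?_⟩
  · intro t
    dsimp only
    split_ifs with h
    · exact hne₁ _ (by omega) (by omega)
    · exact hne₂ _ (by omega) (by omega)
  · intro t ht
    dsimp only
    rcases lt_trichotomy t i with h | rfl | h
    · rw [if_pos (by omega), if_pos h.le]
      by_cases h' : t ≤ t₁
      · left
        congr 1
        omega
      · rw [max_eq_left (by omega), max_eq_left (by omega)]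
        exact hφ t (Nat.zero_le _) h
    · rw [if_neg (by omega), if_pos le_rfl, max_eq_left (by omega), hi, ← hi']
      by_cases h' : t₂ ≤ t
      · left
        congr 1
        omega
      · rw [min_eq_left (by omega)]
        exact hχ t le_rfl ht
    · rw [if_neg (by omega), if_neg (by omega)]
      by_cases h' : t₂ ≤ t
      · left
        congr 1
        omega
      · rw [min_eq_left (by omega), min_eq_left (by omega)]
        exact hχ t h.le ht
  · dsimp only
    rw [if_pos ht₁.le, max_eq_right (by omega)]
    rcases hφ t₁ (Nat.zero_le _) ht₁ with h | h
    · exact absurd (h.trans hx₁) (hne₁ _ (by omega) (by omega))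
    · rwa [hx₁] at h
  · have hval : (if t₂ ≤ i then φ (max t₂ (t₁ + 1)) else χ (min t₂ t₂)) = χ t₂ := by
      split_ifs with h
      · obtain rfl : t₂ = i := le_antisymm h ht₂
        rw [max_eq_left (by omega), hi, hi']
      · rw [min_self]
    dsimp only
    rw [hval]
    rcases hχ t₂ ht₂ ht₂m with h | h
    · exact absurd (h.symm.trans hx₂) (hne₂ _ ht₂ le_rfl)
    · rw [h, hx₂, Sym2.eq_swap]

/-- A person who hears their own information can be removed together with two calls. -/
theorem exists_removal (hf : Complete f m) (h : ¬ NoEcho f m) :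
    ∃ (x : V) (g : ℕ → Sym2 {v // v ≠ x}), Complete g m ∧
      (calls g m).card + 2 ≤ (calls f m).card := by
  classical
  obtain ⟨x, ψ, t₁, t₂, hψx, hψ, h12, h2m, hc1, hc2⟩ := exists_excursion h
  -- At time `t` the holder `ψ t` stands in for `x`. The calls at `t₁` and `t₂` join `x` to its
  -- stand-in and so become diagonal.
  set r : ℕ → V → {v // v ≠ x} := fun t p => if h : p = x then ⟨ψ t, hψx t⟩ else ⟨p, h⟩ with hr
  have hrx : ∀ t, r t x = ⟨ψ t, hψx t⟩ := fun t => by simp [hr]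
  have hrne : ∀ t p (hp : p ≠ x), r t p = ⟨p, hp⟩ := fun t p hp => by simp [hr, hp]
  refine ⟨x, fun t => (f t).map (r t), ?_, ?_⟩
  · intro u w
    obtain ⟨φ, h0, hm, hφ⟩ := hf u w
    refine ⟨fun t => r t (φ t), ?_, ?_, ?_⟩
    · simp [h0, hrne _ _ u.2]
    · simp [hm, hrne _ _ w.2]
    · intro t ht0 htm
      dsimp only
      have hstay : φ (t + 1) = φ t → r (t + 1) (φ (t + 1)) = r t (φ t) ∨
          (f t).map (r t) = s(r t (φ t), r (t + 1) (φ (t + 1))) := by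
        intro h
        rw [h]
        by_cases hx : φ t = x
        · rw [hx, hrx, hrx]
          rcases hψ t htm with h | h
          · simp [h]
          · right
            rw [h, Sym2.map_mk, hrne _ _ (hψx t), hrne _ _ (hψx (t + 1))]
        · simp [hrne _ _ hx]
      rcases hφ t ht0 htm with h | h
      · exact hstay h
      by_cases heq : φ (t + 1) = φ t
      · exact hstay heq
      right
      rw [h, Sym2.map_mk]
      by_cases hx : φ (t + 1) = x
      -- The call at time `t` involves `x`, so the excursion cannot use it and the stand-in does not
      -- change.
      · have : ψ (t + 1) = ψ t := by
          refine (hψ t htm).resolve_right ?_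
          intro h'
          rw [h, hx, Sym2.eq_iff] at h'
          rcases h' with h' | h'
          · exact hψx _ h'.2.symm
          · exact hψx _ h'.2.symm
        simp only [hx, hrx, this]
      · rw [hrne t _ hx, hrne (t + 1) _ hx]
  · have hsub : calls (fun t => (f t).map (r t)) m ⊆ ((calls f m).erase t₁).erase t₂ := by
      intro t ht
      obtain ⟨htm, hd⟩ := mem_calls.1 ht
      simp only [Finset.mem_erase]
      refine ⟨?_, ?_, mem_calls.2 ⟨htm, ?_⟩⟩
      · rintro rfl
        rw [hc2, Sym2.map_mk, hrx, hrne _ _ (hψx _)] at hd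
        exact hd rfl
      · rintro rfl
        rw [hc1, Sym2.map_mk, hrx, hrne _ _ (hψx _)] at hd
        exact hd rfl
      · intro h
        refine hd ?_
        generalize f t = e at h
        induction e with
        | h a b => exact congrArg (r t) h
    have h1 : t₁ ∈ calls f m := mem_calls.2 ⟨h12.trans h2m, by
      rw [hc1, Sym2.mk_isDiag_iff]; exact (hψx _).symm⟩
    have h2 : t₂ ∈ (calls f m).erase t₁ := Finset.mem_erase.2 ⟨h12.ne', mem_calls.2 ⟨h2m, by
      rw [hc2, Sym2.mk_isDiag_iff]; exact (hψx _).symm⟩⟩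
    have := Finset.card_le_card hsub
    have := Finset.card_erase_add_one h2
    have := Finset.card_erase_add_one h1
    omega

/-! ### The gossip bound -/

open Classical in
/-- The calls that `x` takes part in. -/
noncomputable def callsOf (f : ℕ → Sym2 V) (m : ℕ) (x : V) : Finset ℕ :=
  (calls f m).filter fun i => x ∈ f i

theorem mem_callsOf {x : V} {i : ℕ} : i ∈ callsOf f m x ↔ i ∈ calls f m ∧ x ∈ f i := by
  simp [callsOf]

theorem card_filter_mem_le [Fintype V] [DecidableEq V] (e : Sym2 V) :
    (Finset.univ.filter fun v => v ∈ e).card ≤ 2 := by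
  induction e with
  | h a b =>
    refine (Finset.card_le_card (t := {a, b}) ?_).trans Finset.card_le_two
    intro v
    simp

theorem sum_card_callsOf_le [Fintype V] (f : ℕ → Sym2 V) (m : ℕ) :
    ∑ x, (callsOf f m x).card ≤ 2 * (calls f m).card := by
  classical
  have := Finset.sum_card_bipartiteAbove_eq_sum_card_bipartiteBelow
    (s := (Finset.univ : Finset V)) (t := calls f m) (fun x i => x ∈ f i)
  simp only [Finset.bipartiteAbove, Finset.bipartiteBelow] at this
  simp only [callsOf]
  rw [mul_comm, ← smul_eq_mul]
  convert this.trans_le (Finset.sum_le_card_nsmul _ _ 2 fun i _ => card_filter_mem_le (f i))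

/-- If everyone takes part in a call out of a set, the set has at least half as many calls
as there are people. -/
theorem card_le_two_mul_card [Fintype V] {F : Finset ℕ} (c : V → ℕ) (hc : ∀ v, c v ∈ F)
    (hf : ∀ v, v ∈ f (c v)) : Fintype.card V ≤ 2 * F.card := by
  classical
  refine Finset.card_le_mul_card_image_of_maps_to (fun v _ => hc v) 2 fun i _ => ?_
  refine (Finset.card_le_card ?_).trans (card_filter_mem_le (f i))
  intro v
  simp only [Finset.mem_filter, Finset.mem_univ, true_and]
  rintro rfl
  exact hf v

theorem card_le_of_noEcho [Fintype V] [Nonempty V] (hf : Complete f m) (he : NoEcho f m) :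
    2 * Fintype.card V ≤ (calls f m).card + 4 := by
  classical
  by_contra! hlt
  have hOI : ∀ x : V, ∃ O I : Finset ℕ, O ⊆ calls f m ∧ I ⊆ calls f m ∧
      (∀ i ∈ O, ∃ u ∈ f i, Reaches f 0 i x u) ∧ (∀ i ∈ I, ∃ u ∈ f i, Reaches f (i + 1) m u x) ∧
      2 * Fintype.card V ≤ (O ∪ I).card + (callsOf f m x).card + 2 := by
    intro x
    obtain ⟨O, hO, hOc, hOr⟩ := exists_informing_calls hf x
    obtain ⟨I, hI, hIc, hIr⟩ := exists_departing_calls hf x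
    refine ⟨O, I, hO, hI, hOr, hIr, ?_⟩
    -- Such a call receives information from `x`, and an end of it passes information on to `x`.
    -- Without echo that end is `x`.
    have hsub : O ∩ I ⊆ callsOf f m x := by
      intro i hi
      rw [Finset.mem_inter] at hi
      refine mem_callsOf.2 ⟨hO hi.1, ?_⟩
      obtain ⟨u, hu, hru⟩ := hOr i hi.1
      obtain ⟨w, hw, hrw⟩ := hIr i hi.2
      have him := (mem_calls.1 (hO hi.1)).1
      have : Reaches f 0 (i + 1) x w := by
        refine hru.trans (Nat.zero_le _) (Nat.le_succ _) ?_
        by_cases h : u = w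
        · exact h ▸ Reaches.stay _ _ _ _
        · exact Reaches.single ((Sym2.mem_and_mem_iff h).1 ⟨hu, hw⟩)
      exact he x w (i + 1) him this hrw ▸ hw
    have := Finset.card_le_card hsub
    have := Finset.card_union_add_card_inter O I
    omega
  -- `O ∪ I` has at most `2n - 5` elements.
  have hdeg : ∀ x, 3 ≤ (callsOf f m x).card := by
    intro x
    obtain ⟨O, I, hO, hI, -, -, h⟩ := hOI x
    have := Finset.card_le_card (Finset.union_subset hO hI)
    omega
  have hne : ∀ x, (callsOf f m x).Nonempty := fun x =>
    Finset.card_pos.1 (by have := hdeg x; omega)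
  set fst : V → ℕ := fun x => (callsOf f m x).min' (hne x) with hfst
  set lst : V → ℕ := fun x => (callsOf f m x).max' (hne x) with hlst
  have hfst_mem : ∀ x, fst x ∈ callsOf f m x := fun x => Finset.min'_mem _ _
  have hlst_mem : ∀ x, lst x ∈ callsOf f m x := fun x => Finset.max'_mem _ _
  have hF : ∀ x, IsFirst f m (fst x) := fun x =>
    isFirst_of_first hf he (mem_callsOf.1 (hfst_mem x)).1 (mem_callsOf.1 (hfst_mem x)).2
      fun k hk hxk => Finset.min'_le _ _ (mem_callsOf.2 ⟨hk, hxk⟩)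
  have hL : ∀ x, IsLast f m (lst x) := fun x =>
    isLast_of_last hf he (mem_callsOf.1 (hlst_mem x)).2
      fun k hk hxk => Finset.le_max' _ _ (mem_callsOf.2 ⟨hk, hxk⟩)
  have hF_eq : ∀ x, ∀ i ∈ callsOf f m x, IsFirst f m i → i = fst x := fun x i hi h =>
    le_antisymm (h x (mem_callsOf.1 hi).2 _ (mem_callsOf.1 (hfst_mem x)).1
      (mem_callsOf.1 (hfst_mem x)).2) (Finset.min'_le _ _ hi)
  have hL_eq : ∀ x, ∀ i ∈ callsOf f m x, IsLast f m i → i = lst x := fun x i hi h =>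
    le_antisymm (Finset.le_max' _ _ hi) (h x (mem_callsOf.1 hi).2 _ (mem_callsOf.1 (hlst_mem x)).1
      (mem_callsOf.1 (hlst_mem x)).2)
  set F := (calls f m).filter (IsFirst f m) with hFdef
  set L := (calls f m).filter (IsLast f m) with hLdef
  set M := (calls f m).filter (fun i => ¬ IsFirst f m i ∧ ¬ IsLast f m i) with hMdef
  have hFc : Fintype.card V ≤ 2 * F.card := card_le_two_mul_card (f := f) fst
    (fun x => Finset.mem_filter.2 ⟨(mem_callsOf.1 (hfst_mem x)).1, hF x⟩)
    fun x => (mem_callsOf.1 (hfst_mem x)).2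
  have hLc : Fintype.card V ≤ 2 * L.card := card_le_two_mul_card (f := f) lst
    (fun x => Finset.mem_filter.2 ⟨(mem_callsOf.1 (hlst_mem x)).1, hL x⟩)
    fun x => (mem_callsOf.1 (hlst_mem x)).2
  have hFL : Disjoint F L := by
    rw [Finset.disjoint_left]
    intro i hi hi'
    obtain ⟨hic, hiF⟩ := Finset.mem_filter.1 hi
    have hiL := (Finset.mem_filter.1 hi').2
    obtain ⟨x, hx⟩ : ∃ x, x ∈ f i := ⟨_, Sym2.out_fst_mem _⟩
    have : callsOf f m x ⊆ {i} := by
      intro k hk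
      obtain ⟨hkc, hxk⟩ := mem_callsOf.1 hk
      exact Finset.mem_singleton.2 (le_antisymm (hiL x hx k hkc hxk) (hiF x hx k hkc hxk))
    have := Finset.card_le_card this
    have := hdeg x
    rw [Finset.card_singleton] at *
    omega
  have hFLM : F.card + L.card + M.card ≤ (calls f m).card := by
    rw [← Finset.card_union_of_disjoint hFL, ← Finset.card_union_of_disjoint]
    · refine Finset.card_le_card ?_
      simp [hFdef, hLdef, hMdef, Finset.union_subset_iff, Finset.filter_subset]
    · rw [Finset.disjoint_left]
      intro i hi hi'
      simp only [hFdef, hLdef, hMdef, Finset.mem_union, Finset.mem_filter] at hi hi'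
      tauto
  -- The degrees sum to at most `2 (2n - 5) < 4n`.
  obtain ⟨x, hx⟩ : ∃ x, (callsOf f m x).card ≤ 3 := by
    by_contra! h
    have h1 := sum_card_callsOf_le f m
    have h2 := Finset.card_nsmul_le_sum Finset.univ (fun x => (callsOf f m x).card) 4
      fun x _ => h x
    rw [Finset.card_univ, smul_eq_mul] at h2
    omega
  obtain ⟨O, I, hO, hI, hOr, hIr, hcard⟩ := hOI x
  -- For this `x` the union has at least `2n - 5` elements, so it exhausts the calls.
  have hOIeq : O ∪ I = calls f m :=
    Finset.eq_of_subset_of_card_le (Finset.union_subset hO hI) (by omega)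
  set E : Finset (Sym2 V) := M.image f ∪ {f (fst x), f (lst x)} with hE
  set H : SimpleGraph V := SimpleGraph.fromEdgeSet (E : Set (Sym2 V)) with hH
  have hreach : ∀ p q, s(p, q) ∈ E → H.Reachable p q := by
    intro p q h
    by_cases hpq : p = q
    · rw [hpq]
    · exact SimpleGraph.Adj.reachable ((SimpleGraph.fromEdgeSet_adj _).2 ⟨h, hpq⟩)
  have hmid : ∀ j ∈ calls f m, ¬ IsFirst f m j → ¬ IsLast f m j →
      ∀ p q, f j = s(p, q) → H.Reachable p q := by
    intro j hj h1 h2 p q hpq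
    refine hreach p q (hpq ▸ Finset.mem_union_left _ (Finset.mem_image_of_mem f ?_))
    exact Finset.mem_filter.2 ⟨hj, h1, h2⟩
  have hconn : ∀ v, H.Reachable x v := by
    intro v
    -- With three calls, `v` has one that is neither first nor last. It is an edge of `H`, and one
    -- of its ends is joined to `x` because it lies in `O ∪ I`.
    obtain ⟨i, hi⟩ : (callsOf f m v \ {fst v, lst v}).Nonempty := by
      rw [← Finset.card_pos]
      have := Finset.le_card_sdiff {fst v, lst v} (callsOf f m v)
      have := Finset.card_le_two (a := fst v) (b := lst v)
      have := hdeg v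
      omega
    simp only [Finset.mem_sdiff, Finset.mem_insert, Finset.mem_singleton, not_or] at hi
    obtain ⟨hiv, hne1, hne2⟩ := hi
    obtain ⟨hic, hvi⟩ := mem_callsOf.1 hiv
    have key : ∃ u ∈ f i, H.Reachable x u := by
      have hi' := hic
      rw [← hOIeq, Finset.mem_union] at hi'
      rcases hi' with h | h
      · obtain ⟨u, hu, hr⟩ := hOr i h
        refine ⟨u, hu, reachable_of_reaches hmid ?_ hic hu hr⟩
        intro j hj hjF q hq
        refine hreach x q ?_
        rw [← hq, hF_eq x j (mem_callsOf.2 ⟨hj, by simp [hq]⟩) hjF]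
        simp [hE]
      · obtain ⟨u, hu, hr⟩ := hIr i h
        refine ⟨u, hu, reachable_of_reaches' hmid ?_ hic hu hr⟩
        intro j hj hjL q hq
        refine hreach x q ?_
        rw [← hq, hL_eq x j (mem_callsOf.2 ⟨hj, by simp [hq]⟩) hjL]
        simp [hE]
    obtain ⟨u, hu, hr⟩ := key
    by_cases huv : u = v
    · exact huv ▸ hr
    · exact hr.trans (hmid i hic (fun h => hne1 (hF_eq v i hiv h))
        (fun h => hne2 (hL_eq v i hiv h)) u v ((Sym2.mem_and_mem_iff huv).1 ⟨hu, hvi⟩))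
  have hHc : H.Connected := (SimpleGraph.connected_iff _).2
    ⟨fun u v => (hconn u).symm.trans (hconn v), inferInstance⟩
  have h1 := hHc.card_vert_le_card_edgeSet_add_one
  have h2 : Nat.card H.edgeSet ≤ E.card := by
    rw [Nat.card_coe_set_eq, ← Set.ncard_coe_finset]
    refine Set.ncard_le_ncard ?_
    rw [hH, SimpleGraph.edgeSet_fromEdgeSet]
    exact Set.sdiff_subset
  have h3 : E.card ≤ M.card + 2 :=
    (Finset.card_union_le _ _).trans (add_le_add Finset.card_image_le Finset.card_le_two)
  rw [Nat.card_eq_fintype_card] at h1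
  omega

/-- **Gossip theorem**: informing everyone of everything takes at least `2 n - 4` calls. -/
theorem Complete.two_mul_card_le {V : Type*} [Fintype V] {f : ℕ → Sym2 V} {m : ℕ}
    (hf : Complete f m) : 2 * Fintype.card V ≤ (calls f m).card + 4 := by
  classical
  induction hn : Fintype.card V generalizing V with
  | zero => omega
  | succ n ih =>
    have : Nonempty V := Fintype.card_pos_iff.1 (by omega)
    by_cases he : NoEcho f m
    · exact hn ▸ card_le_of_noEcho hf he
    · obtain ⟨x, g, hg, hle⟩ := exists_removal hf he
      have := ih hg (by simp [hn])
      omega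

end Gossip

/-! ### From temporal graphs to call sequences -/

namespace Gossip

theorem card_calls_le {V : Type*} (f : ℕ → Sym2 V) (m : ℕ) : (calls f m).card ≤ m := by
  classical
  simpa [calls] using Finset.card_filter_le (Finset.range m) fun i => ¬ (f i).IsDiag

/-- A walk with increasing labels is followed by a token when the calls are sorted by label. -/
theorem reaches_of_walk {V : Type*} {G : TemporalGraph V} {f : ℕ → Sym2 V} {k : ℕ}
    {idx : Sym2 V → ℕ} (hidx : ∀ e ∈ G.graph.edgeSet, idx e < k ∧ f (idx e) = e)
    (hmono : ∀ e ∈ G.graph.edgeSet, ∀ e' ∈ G.graph.edgeSet, G.label e < G.label e' →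
      idx e < idx e') {u v : V} (p : G.graph.Walk u v)
    (hp : (p.edges.map G.label).IsChain (· < ·)) (j : ℕ) (hj : ∀ e ∈ p.edges, j ≤ idx e) :
    Reaches f j k u v := by
  induction p generalizing j with
  | nil => exact Reaches.stay _ _ _ _
  | @cons u w v h p ih =>
    rw [SimpleGraph.Walk.edges_cons] at hp hj
    rw [List.map_cons, List.isChain_iff_pairwise, List.pairwise_cons] at hp
    have he : s(u, w) ∈ G.graph.edgeSet := h
    obtain ⟨h1, h2⟩ := hidx _ he
    have hj' := hj _ List.mem_cons_self
    refine (Reaches.stay _ _ (idx s(u, w)) _).trans hj' h1.le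
      ((Reaches.single h2).trans (Nat.le_succ _) h1 (ih ?_ _ ?_))
    · exact List.isChain_iff_pairwise.2 hp.2
    · intro e hep
      exact hmono _ he _ (p.edges_subset_edgeSet hep) (hp.1 _ (List.mem_map_of_mem hep))

end Gossip

open Gossip in
/-- A temporal graph has at least `2 n - 4` edges and ordered pairs without a strict temporal
path. -/
theorem TemporalGraph.two_mul_card_le {V : Type*} [Fintype V] (G : TemporalGraph V) :
    2 * Fintype.card V ≤
      G.graph.edgeSet.ncard + ∑ v, ((G.reach (· < ·) v)ᶜ).ncard + 4 := by
  classical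
  rcases isEmpty_or_nonempty V with hV | ⟨⟨x⟩⟩
  · simp [Fintype.card_eq_zero]
  set E : Finset (Sym2 V) := G.graph.edgeSet.toFinset with hE
  set Q : Finset (Σ _ : V, V) :=
    Finset.univ.sigma fun v => ((G.reach (· < ·) v)ᶜ).toFinset with hQ
  have hEc : G.graph.edgeSet.ncard = E.card := Set.ncard_eq_toFinset_card' _
  have hQc : ∑ v, ((G.reach (· < ·) v)ᶜ).ncard = Q.card := by
    rw [hQ, Finset.card_sigma]
    exact Finset.sum_congr rfl fun v _ => Set.ncard_eq_toFinset_card' _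
  rw [hEc, hQc]
  set g : Fin E.card → ℤ := fun i => G.label (E.equivFin.symm i)
  set σ := Tuple.sort g
  have hσ : Monotone (g ∘ σ) := Tuple.monotone_sort g
  -- The edges in label order, then the unreached pairs, then diagonal padding. Equal labels may be
  -- ordered arbitrarily, since strict paths never use two of them.
  set f : ℕ → Sym2 V := fun i =>
    if h : i < E.card then (E.equivFin.symm (σ ⟨i, h⟩) : Sym2 V)
    else if h : i - E.card < Q.card then
      s((Q.equivFin.symm ⟨i - E.card, h⟩ : Σ _ : V, V).1, (Q.equivFin.symm ⟨i - E.card, h⟩).1.2)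
    else s(x, x) with hf
  set idx : Sym2 V → ℕ := fun e => if h : e ∈ E then σ.symm (E.equivFin ⟨e, h⟩) else 0 with hidx
  have h1 : ∀ e ∈ G.graph.edgeSet, idx e < E.card ∧ f (idx e) = e := by
    intro e he
    have he' : e ∈ E := Set.mem_toFinset.2 he
    simp [hidx, hf, he']
  have h2 : ∀ e ∈ G.graph.edgeSet, ∀ e' ∈ G.graph.edgeSet, G.label e < G.label e' →
      idx e < idx e' := by
    intro e he e' he' hlt
    have hE₁ : e ∈ E := Set.mem_toFinset.2 he
    have hE₂ : e' ∈ E := Set.mem_toFinset.2 he'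
    simp only [hidx, hE₁, hE₂, dif_pos, Fin.val_fin_lt]
    refine hσ.reflect_lt ?_
    simpa [g] using hlt
  have hcomplete : Complete f (E.card + Q.card) := by
    intro u v
    by_cases huv : v ∈ G.reach (· < ·) u
    · obtain ⟨p, hp⟩ := huv
      exact (reaches_of_walk h1 h2 p hp 0 fun _ _ => Nat.zero_le _).trans (Nat.zero_le _)
        (Nat.le_add_right _ _) (Reaches.stay _ _ _ _)
    · have hmem : (⟨u, v⟩ : Σ _ : V, V) ∈ Q := by simp [hQ, huv]
      set i := Q.equivFin ⟨⟨u, v⟩, hmem⟩ with hi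
      have hfi : f (E.card + i) = s(u, v) := by simp [hf, hi]
      exact (Reaches.stay _ _ _ _).trans (Nat.zero_le _) (by omega)
        ((Reaches.single hfi).trans (Nat.le_succ _) (by omega) (Reaches.stay _ _ _ _))
  have := hcomplete.two_mul_card_le
  have := card_calls_le f (E.card + Q.card)
  omega

/-! ### The formed graph and the bound on the social cost -/

namespace CreationGame

/-- Some end of the edge between `u` and `v` buys it with label `l`. -/
def Bought {V : Type*} (s : Profile V) (u v : V) (l : ℤ) : Prop := (v, l) ∈ s u ∨ (u, l) ∈ s v

variable {V : Type*} {s : Profile V} {u v w x : V} {l : ℤ}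

theorem formed_adj : (formed s).graph.Adj u v ↔ u ≠ v ∧ ∃ l, Bought s u v l := by
  simp only [formed, SimpleGraph.fromRel_adj, Bought, exists_or]

theorem formed_label (s : Profile V) (u v : V) :
    (formed s).label s(u, v) = sInf {l | Bought s u v l} := by
  simp only [formed]
  congr 1
  ext l
  simp only [Set.mem_ofPred_eq, Sym2.eq_iff, Bought]
  constructor
  · rintro ⟨a, b, ⟨rfl, rfl⟩ | ⟨rfl, rfl⟩, h⟩
    · exact Or.inl h
    · exact Or.inr h
  · rintro (h | h)
    · exact ⟨u, v, Or.inl ⟨rfl, rfl⟩, h⟩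
    · exact ⟨v, u, Or.inr ⟨rfl, rfl⟩, h⟩

theorem bought_label (h : (formed s).graph.Adj u v) :
    Bought s u v ((formed s).label s(u, v)) := by
  classical
  rw [formed_label]
  -- Finiteness of strategies matters here: an unbounded set of labels would give `sInf` a junk
  -- value.
  refine Int.csInf_mem (formed_adj.1 h).2 (Set.Finite.bddBelow ?_)
  refine (((s u).image Prod.snd ∪ (s v).image Prod.snd).finite_toSet).subset ?_
  rintro l (h | h)
  · simp only [Finset.coe_union, Finset.coe_image, Set.mem_union]
    exact Or.inl ⟨_, h, rfl⟩
  · simp only [Finset.coe_union, Finset.coe_image, Set.mem_union]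
    exact Or.inr ⟨_, h, rfl⟩

theorem ncard_edgeSet_formed_le [Fintype V] (s : Profile V) :
    (formed s).graph.edgeSet.ncard ≤ ∑ u, (s u).card := by
  classical
  rw [← Finset.card_sigma]
  rw [← Set.ncard_coe_finset]
  refine le_trans (Set.ncard_le_ncard ?_ (Set.Finite.image _ (Finset.finite_toSet _)))
    (Set.ncard_image_le (f := fun p : Σ _ : V, V × ℤ => s(p.1, p.2.1)) (Finset.finite_toSet _))
  intro e
  induction e with
  | h u v =>
    intro h
    obtain ⟨-, l, h | h⟩ := formed_adj.1 ((SimpleGraph.mem_edgeSet _).1 h)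
    · exact ⟨⟨u, v, l⟩, by simpa using h, rfl⟩
    · exact ⟨⟨v, u, l⟩, by simpa using h, Sym2.eq_swap⟩

theorem strictUniformCost_eq (K M : ℝ) (s : Profile V) (u : V) :
    strictUniformCost K M s u = (s u).card
      + M * (((s u).filter fun p => p.2 < 1).card : ℝ)
      + K * (((formed s).reach (· < ·) u)ᶜ.ncard : ℝ) := by
  simp [strictUniformCost, cost, uniformLabelCost, positivePenalty]

theorem two_mul_card_sub_le_socialCost [Fintype V] {K M : ℝ} (hK : 1 ≤ K) (hM : 0 ≤ M)
    (s : Profile V) : 2 * (Fintype.card V : ℝ) - 4 ≤ socialCost (strictUniformCost K M) s := by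
  have h1 := (formed s).two_mul_card_le
  have h2 := ncard_edgeSet_formed_le s
  have h3 : 2 * Fintype.card V ≤
      ∑ v, ((s v).card + (((formed s).reach (· < ·) v)ᶜ).ncard) + 4 := by
    rw [Finset.sum_add_distrib]
    omega
  have h4 : ∑ v, (((s v).card : ℝ) + ((((formed s).reach (· < ·) v)ᶜ).ncard : ℝ))
      ≤ socialCost (strictUniformCost K M) s := by
    refine Finset.sum_le_sum fun v _ => ?_
    rw [strictUniformCost_eq]
    have := mul_nonneg hM (Nat.cast_nonneg (((s v).filter fun p => p.2 < 1).card) : (0 : ℝ) ≤ _)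
    have := mul_le_mul_of_nonneg_right hK
      (Nat.cast_nonneg ((((formed s).reach (· < ·) v)ᶜ).ncard) : (0 : ℝ) ≤ _)
    linarith
  have h5 : (2 * Fintype.card V : ℝ) ≤
      ∑ v, (((s v).card : ℝ) + ((((formed s).reach (· < ·) v)ᶜ).ncard : ℝ)) + 4 := by
    exact_mod_cast h3
  linarith

/-- An invariant for arrivals. Allowing every bought label, not just the minimal one, only enlarges
the set of possible steps, and spares computing labels after a deviation. -/
theorem exists_of_walk {P : V → ℤ → Prop}
    (step : ∀ w l w' l', P w l → Bought s w w' l' → l < l' → P w' l')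
    (p : (formed s).graph.Walk w v) (hl : P w l)
    (hp : (l :: p.edges.map (formed s).label).IsChain (· < ·)) : ∃ l', P v l' := by
  induction p generalizing l with
  | nil => exact ⟨l, hl⟩
  | cons h p ih =>
    rw [SimpleGraph.Walk.edges_cons, List.map_cons, List.isChain_cons_cons] at hp
    exact ih (step _ _ _ _ hl (bought_label h) hp.1) hp.2

/-- A set of arrivals (agent, label) that contains all possible first steps from `u` and is closed
under later steps contains an arrival at every agent reached from `u`. -/
theorem exists_of_mem_reach {P : V → ℤ → Prop} (start : ∀ w l, Bought s u w l → P w l)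
    (step : ∀ w l w' l', P w l → Bought s w w' l' → l < l' → P w' l')
    (h : v ∈ (formed s).reach (· < ·) u) : v = u ∨ ∃ l, P v l := by
  obtain ⟨p, hp⟩ := h
  cases p with
  | nil => exact Or.inl rfl
  | cons h p =>
    rw [SimpleGraph.Walk.edges_cons, List.map_cons] at hp
    exact Or.inr (exists_of_walk step p (start _ _ (bought_label h)) hp)

/-- The edge between `u` and `v` is bought, with the label `l` only. -/
def OnlyBought (s : Profile V) (u v : V) (l : ℤ) : Prop :=
  u ≠ v ∧ ∀ l', Bought s u v l' ↔ l' = l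

theorem OnlyBought.adj (h : OnlyBought s u v l) : (formed s).graph.Adj u v :=
  formed_adj.2 ⟨h.1, l, (h.2 l).2 rfl⟩

theorem OnlyBought.label_eq (h : OnlyBought s u v l) : (formed s).label s(u, v) = l :=
  (h.2 _).1 (bought_label h.adj)

theorem mem_reach_self (s : Profile V) (u : V) : u ∈ (formed s).reach (· < ·) u :=
  ⟨.nil, by simp⟩

theorem mem_reach_of_one (h : OnlyBought s u v l) : v ∈ (formed s).reach (· < ·) u :=
  ⟨.cons h.adj .nil, by simp⟩

theorem mem_reach_of_two {l' : ℤ} (h : OnlyBought s u v l) (h' : OnlyBought s v w l')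
    (hl : l < l') : w ∈ (formed s).reach (· < ·) u :=
  ⟨.cons h.adj (.cons h'.adj .nil), by simp [h.label_eq, h'.label_eq, hl]⟩

theorem mem_reach_of_three {l' l'' : ℤ} (h : OnlyBought s u v l) (h' : OnlyBought s v w l')
    (h'' : OnlyBought s w x l'') (hl : l < l') (hl' : l' < l'') :
    x ∈ (formed s).reach (· < ·) u :=
  ⟨.cons h.adj (.cons h'.adj (.cons h''.adj .nil)),
    by simp [h.label_eq, h'.label_eq, h''.label_eq, hl, hl']⟩

theorem mem_reach_of_four {y : V} {l' l'' l''' : ℤ} (h : OnlyBought s u v l)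
    (h' : OnlyBought s v w l') (h'' : OnlyBought s w x l'') (h''' : OnlyBought s x y l''')
    (hl : l < l') (hl' : l' < l'') (hl'' : l'' < l''') : y ∈ (formed s).reach (· < ·) u :=
  ⟨.cons h.adj (.cons h'.adj (.cons h''.adj (.cons h'''.adj .nil))),
    by simp [h.label_eq, h'.label_eq, h''.label_eq, h'''.label_eq, hl, hl', hl'']⟩

/-- If `u` buys at most one edge and loses someone by buying nothing, then `u` cannot improve. -/
theorem not_cost_update_lt [Finite V] [DecidableEq V] {K M : ℝ} (hK : 1 ≤ K) (hM : 0 ≤ M)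
    (hs : strictUniformCost K M s u ≤ 1)
    (hv : v ∉ (formed (Function.update s u ∅)).reach (· < ·) u) (S : Strategy V) :
    ¬ strictUniformCost K M (Function.update s u S) u < strictUniformCost K M s u := by
  rw [not_lt]
  refine hs.trans ?_
  rw [strictUniformCost_eq, Function.update_self]
  have h1 := mul_nonneg hM (Nat.cast_nonneg ((S.filter fun p => p.2 < 1).card) : (0 : ℝ) ≤ _)
  have h2 : (0 : ℝ) ≤ (((formed (Function.update s u S)).reach (· < ·) u)ᶜ.ncard : ℝ) :=
    Nat.cast_nonneg _
  rcases S.eq_empty_or_nonempty with rfl | hS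
  · have h3 : (1 : ℝ) ≤ (((formed (Function.update s u ∅)).reach (· < ·) u)ᶜ.ncard : ℝ) := by
      exact_mod_cast (Set.ncard_pos (Set.toFinite _)).2 ⟨v, hv⟩
    simp only [Finset.card_empty, Nat.cast_zero, Finset.filter_empty, mul_zero] at *
    nlinarith
  · have h3 : (1 : ℝ) ≤ (S.card : ℝ) := by exact_mod_cast Finset.card_pos.2 hS
    nlinarith

theorem mem_update [DecidableEq V] {S : Strategy V} : (v, l) ∈ Function.update s u S w ↔
    (w = u ∧ (v, l) ∈ S) ∨ (w ≠ u ∧ (v, l) ∈ s w) := by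
  by_cases h : w = u
  · subst h
    simp
  · simp [h]

/-! ### The ring profile -/

variable [Fintype V] [DecidableEq V] {a b c d : V} {N : ℤ}

/-- The labeled 4-cycle `a, b, c, d` together with edges to `a` with label `1` and to `c` with label
`N + 2` for every other agent. -/
def ringProfile (a b c d : V) (N : ℤ) : Profile V := fun v =>
  if v = a then {(b, N)} else if v = b then {(c, N + 1)}
  else if v = c then insert (d, N) (({a, b, c, d} : Finset V)ᶜ.image fun v => (v, N + 2))
  else if v = d then {(a, N + 1)} else {(a, 1)}

theorem mem_ringProfile (h : [a, b, c, d].Nodup) : (v, l) ∈ ringProfile a b c d N u ↔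
    (u = a ∧ v = b ∧ l = N) ∨ (u = b ∧ v = c ∧ l = N + 1) ∨ (u = c ∧ v = d ∧ l = N) ∨
    (u = d ∧ v = a ∧ l = N + 1) ∨
    (u = c ∧ (v ≠ a ∧ v ≠ b ∧ v ≠ c ∧ v ≠ d) ∧ l = N + 2) ∨
    ((u ≠ a ∧ u ≠ b ∧ u ≠ c ∧ u ≠ d) ∧ v = a ∧ l = 1) := by
  simp only [List.nodup_cons, List.mem_cons, List.not_mem_nil, not_or] at h
  have himage : (v, l) ∈ ({a, b, c, d} : Finset V)ᶜ.image (fun v => (v, N + 2)) ↔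
      (v ≠ a ∧ v ≠ b ∧ v ≠ c ∧ v ≠ d) ∧ l = N + 2 := by
    simp only [Finset.mem_image, Finset.mem_compl, Finset.mem_singleton, Finset.mem_insert,
      Prod.mk.injEq, not_or]
    exact ⟨by rintro ⟨w, hw, rfl, rfl⟩; exact ⟨hw, rfl⟩, fun h => ⟨v, h.1, rfl, h.2.symm⟩⟩
  unfold ringProfile
  split_ifs <;> simp only [Finset.mem_singleton, Finset.mem_insert, himage, Prod.mk.injEq] <;> grind

theorem card_ringProfile_c (h : [a, b, c, d].Nodup) :
    (ringProfile a b c d N c).card + 3 = Fintype.card V := by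
  have h' := h
  simp only [List.nodup_cons, List.mem_cons, List.not_mem_nil, not_or] at h'
  have h4 : ({a, b, c, d} : Finset V).card = 4 := by
    simpa using List.toFinset_card_of_nodup h
  have := Finset.card_add_card_compl ({a, b, c, d} : Finset V)
  have e : ringProfile a b c d N c =
      insert (d, N) (({a, b, c, d} : Finset V)ᶜ.image fun v => (v, N + 2)) := by
    unfold ringProfile
    rw [if_neg (by grind), if_neg (by grind), if_pos rfl]
  rw [e, Finset.card_insert_of_notMem (by simp), Finset.card_image_of_injective]
  · omega
  · intro x y hxy
    exact (Prod.mk.inj hxy).1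

theorem card_ringProfile (h : u ≠ c) : (ringProfile a b c d N u).card = 1 := by
  unfold ringProfile
  split_ifs <;> simp

theorem isRingProfile_ringProfile (h : [a, b, c, d].Nodup) (hV : 4 ≤ Fintype.card V) :
    IsRingProfile (ringProfile a b c d (Fintype.card V)) := by
  have h' := h
  simp only [List.nodup_cons, List.mem_cons, List.not_mem_nil, not_or] at h'
  -- All remaining agents are put on the side of `a`.
  refine ⟨a, b, c, d, ({a, b, c, d} : Finset V)ᶜ, ∅, fun _ => 1, fun _ => Fintype.card V + 2, h,
    by simp, by simp, fun v _ => ⟨le_rfl, ?_, ?_⟩, ?_, ?_, ?_, ?_, ?_, ?_⟩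
  · dsimp only
    omega
  · dsimp only
    omega
  · simp [ringProfile]
  · unfold ringProfile
    rw [if_neg (by grind), if_pos rfl]
  · unfold ringProfile
    rw [if_neg (by grind), if_neg (by grind), if_pos rfl]
  · unfold ringProfile
    rw [if_neg (by grind), if_neg (by grind), if_neg (by grind), if_pos rfl]
  · intro v hv
    simp only [Finset.mem_compl, Finset.mem_insert, Finset.mem_singleton, not_or] at hv
    simp [ringProfile, hv]
  · simp

/-- The cycle labels alternate, so its four agents reach each other in at most two steps. Others
enter at `a` before the cycle is active and are reached from `c` after it. -/
theorem temporallyConnected_ringProfile (h : [a, b, c, d].Nodup) (hN : 1 < N) :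
    (formed (ringProfile a b c d N)).TemporallyConnected (· < ·) := by
  have h' := h
  simp only [List.nodup_cons, List.mem_cons, List.not_mem_nil, not_or] at h'
  set s := ringProfile a b c d N with hs
  have ab : OnlyBought s a b N := ⟨by grind, fun l => by
    simp only [Bought, hs, mem_ringProfile h]; grind⟩
  have ba : OnlyBought s b a N := ⟨by grind, fun l => by
    simp only [Bought, hs, mem_ringProfile h]; grind⟩
  have cd : OnlyBought s c d N := ⟨by grind, fun l => by
    simp only [Bought, hs, mem_ringProfile h]; grind⟩
  have dc : OnlyBought s d c N := ⟨by grind, fun l => by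
    simp only [Bought, hs, mem_ringProfile h]; grind⟩
  have bc : OnlyBought s b c (N + 1) := ⟨by grind, fun l => by
    simp only [Bought, hs, mem_ringProfile h]; grind⟩
  have cb : OnlyBought s c b (N + 1) := ⟨by grind, fun l => by
    simp only [Bought, hs, mem_ringProfile h]; grind⟩
  have da : OnlyBought s d a (N + 1) := ⟨by grind, fun l => by
    simp only [Bought, hs, mem_ringProfile h]; grind⟩
  have ad : OnlyBought s a d (N + 1) := ⟨by grind, fun l => by
    simp only [Bought, hs, mem_ringProfile h]; grind⟩
  have va : ∀ v, (v ≠ a ∧ v ≠ b ∧ v ≠ c ∧ v ≠ d) → OnlyBought s v a 1 := fun v hv =>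
    ⟨by grind, fun l => by simp only [Bought, hs, mem_ringProfile h]; grind⟩
  have cv : ∀ v, (v ≠ a ∧ v ≠ b ∧ v ≠ c ∧ v ≠ d) → OnlyBought s c v (N + 2) := fun v hv =>
    ⟨by grind, fun l => by simp only [Bought, hs, mem_ringProfile h]; grind⟩
  have hw : ∀ w, w = a ∨ w = b ∨ w = c ∨ w = d ∨ (w ≠ a ∧ w ≠ b ∧ w ≠ c ∧ w ≠ d) := by
    intro w
    tauto
  intro u
  rw [Set.eq_univ_iff_forall]
  intro w
  rcases hw u with rfl | rfl | rfl | rfl | hu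
  · rcases hw w with rfl | rfl | rfl | rfl | hw
    · exact mem_reach_self _ _
    · exact mem_reach_of_one ab
    · exact mem_reach_of_two ab bc (by omega)
    · exact mem_reach_of_one ad
    · exact mem_reach_of_three ab bc (cv w hw) (by omega) (by omega)
  · rcases hw w with rfl | rfl | rfl | rfl | hw
    · exact mem_reach_of_one ba
    · exact mem_reach_self _ _
    · exact mem_reach_of_one bc
    · exact mem_reach_of_two ba ad (by omega)
    · exact mem_reach_of_two bc (cv w hw) (by omega)
  · rcases hw w with rfl | rfl | rfl | rfl | hw
    · exact mem_reach_of_two cd da (by omega)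
    · exact mem_reach_of_one cb
    · exact mem_reach_self _ _
    · exact mem_reach_of_one cd
    · exact mem_reach_of_one (cv w hw)
  · rcases hw w with rfl | rfl | rfl | rfl | hw
    · exact mem_reach_of_one da
    · exact mem_reach_of_two dc cb (by omega)
    · exact mem_reach_of_one dc
    · exact mem_reach_self _ _
    · exact mem_reach_of_two dc (cv w hw) (by omega)
  · rcases hw w with rfl | rfl | rfl | rfl | hw
    · exact mem_reach_of_one (va u hu)
    · exact mem_reach_of_two (va u hu) ab (by omega)
    · exact mem_reach_of_three (va u hu) ab bc (by omega) (by omega)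
    · exact mem_reach_of_two (va u hu) ad (by omega)
    · by_cases huw : w = u
      · exact huw ▸ mem_reach_self _ _
      · exact mem_reach_of_four (va u hu) ab bc (cv w hw) (by omega) (by omega) (by omega)

theorem strictUniformCost_ringProfile {K M : ℝ} (h : [a, b, c, d].Nodup) (hN : 1 < N) (u : V) :
    strictUniformCost K M (ringProfile a b c d N) u = ((ringProfile a b c d N u).card : ℝ) := by
  rw [strictUniformCost_eq, temporallyConnected_ringProfile h hN u, Finset.filter_eq_empty_iff.2]
  · simp
  · rintro ⟨v, l⟩ hp
    rw [mem_ringProfile h] at hp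
    dsimp only
    omega

/-! ### The ring profile is an equilibrium -/

theorem notMem_reach_update_a (h : [a, b, c, d].Nodup) :
    b ∉ (formed (Function.update (ringProfile a b c d N) a ∅)).reach (· < ·) a := by
  intro hmem
  have h' := h
  simp only [List.nodup_cons, List.mem_cons, List.not_mem_nil, not_or] at h'
  -- `P` lists all arrivals possible from `a` without its own edge; the next three lemmas use the
  -- same device.
  have := exists_of_mem_reach (P := fun w l => (w = d ∧ l = N + 1) ∨
    ((w ≠ a ∧ w ≠ b ∧ w ≠ c ∧ w ≠ d) ∧ l = 1) ∨ (w = c ∧ l = N + 2)) ?_ ?_ hmem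
  · grind
  all_goals
    simp only [Bought, mem_update, mem_ringProfile h, Finset.notMem_empty]
    grind

theorem notMem_reach_update_b (h : [a, b, c, d].Nodup) (hN : 1 < N) :
    c ∉ (formed (Function.update (ringProfile a b c d N) b ∅)).reach (· < ·) b := by
  intro hmem
  have h' := h
  simp only [List.nodup_cons, List.mem_cons, List.not_mem_nil, not_or] at h'
  have := exists_of_mem_reach (P := fun w l => (w = a ∧ l = N) ∨ (w = d ∧ l = N + 1)) ?_ ?_ hmem
  · grind
  all_goals
    simp only [Bought, mem_update, mem_ringProfile h, Finset.notMem_empty]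
    grind

theorem notMem_reach_update_d (h : [a, b, c, d].Nodup) (hN : 1 < N) :
    a ∉ (formed (Function.update (ringProfile a b c d N) d ∅)).reach (· < ·) d := by
  intro hmem
  have h' := h
  simp only [List.nodup_cons, List.mem_cons, List.not_mem_nil, not_or] at h'
  have := exists_of_mem_reach (P := fun w l => (w = c ∧ l = N) ∨ (w = b ∧ l = N + 1) ∨
    ((w ≠ a ∧ w ≠ b ∧ w ≠ c ∧ w ≠ d) ∧ l = N + 2)) ?_ ?_ hmem
  · grind
  all_goals
    simp only [Bought, mem_update, mem_ringProfile h, Finset.notMem_empty]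
    grind

theorem notMem_reach_update_of_ne (h : [a, b, c, d].Nodup)
    (hu : u ≠ a ∧ u ≠ b ∧ u ≠ c ∧ u ≠ d) :
    a ∉ (formed (Function.update (ringProfile a b c d N) u ∅)).reach (· < ·) u := by
  intro hmem
  have h' := h
  simp only [List.nodup_cons, List.mem_cons, List.not_mem_nil, not_or] at h'
  have := exists_of_mem_reach (P := fun w l => w = c ∧ l = N + 2) ?_ ?_ hmem
  · grind
  all_goals
    simp only [Bought, mem_update, mem_ringProfile h, Finset.notMem_empty]
    grind

/-- The only other edge at `v` has label 1, too early to follow a positive label. -/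
theorem exists_mem_of_mem_reach_c (h : [a, b, c, d].Nodup) (hN : 1 < N) {S : Strategy V}
    (hS : ∀ p ∈ S, 1 ≤ p.2) (hv : v ≠ a ∧ v ≠ b ∧ v ≠ c ∧ v ≠ d)
    (hmem : v ∈ (formed (Function.update (ringProfile a b c d N) c S)).reach (· < ·) c) :
    ∃ l, (v, l) ∈ S := by
  have h' := h
  simp only [List.nodup_cons, List.mem_cons, List.not_mem_nil, not_or] at h'
  have hS' : ∀ v l, (v, l) ∈ S → 1 ≤ l := fun v l h => hS _ h
  have := exists_of_mem_reach (P := fun w l => 1 ≤ l ∧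
    ((w ≠ a ∧ w ≠ b ∧ w ≠ c ∧ w ≠ d) → ∃ l', (w, l') ∈ S)) ?_ ?_ hmem
  · grind
  all_goals
    simp only [Bought, mem_update, mem_ringProfile h]
    grind

/-- If `c` buys only towards agents off the cycle, their edges to `a` come too early, and so does
the edge from `b` to `a` after arriving at `b` at `N + 1`. -/
theorem exists_mem_of_mem_reach_c' (h : [a, b, c, d].Nodup) (hN : 1 < N) {S : Strategy V}
    (hS : ∀ p ∈ S, 1 ≤ p.2)
    (hmem : a ∈ (formed (Function.update (ringProfile a b c d N) c S)).reach (· < ·) c) :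
    ∃ p ∈ S, ¬ (p.1 ≠ a ∧ p.1 ≠ b ∧ p.1 ≠ c ∧ p.1 ≠ d) := by
  have h' := h
  simp only [List.nodup_cons, List.mem_cons, List.not_mem_nil, not_or] at h'
  by_contra! hno
  have hS' : ∀ v l, (v, l) ∈ S → 1 ≤ l := fun v l h => hS _ h
  have hno' : ∀ v l, (v, l) ∈ S → (v ≠ a ∧ v ≠ b ∧ v ≠ c ∧ v ≠ d) := fun v l h => hno _ h
  have := exists_of_mem_reach (P := fun w l => 1 ≤ l ∧ (w = b → N + 1 ≤ l) ∧ w ≠ a ∧ w ≠ d)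
    ?_ ?_ hmem
  · grind
  all_goals
    simp only [Bought, mem_update, mem_ringProfile h]
    grind

theorem card_le_card_add_ncard_compl_reach (h : [a, b, c, d].Nodup) (hN : 1 < N) {S : Strategy V}
    (hS : ∀ p ∈ S, 1 ≤ p.2) : Fintype.card V ≤ S.card + 3 +
      ((formed (Function.update (ringProfile a b c d N) c S)).reach (· < ·) c)ᶜ.ncard := by
  classical
  have h' := h
  simp only [List.nodup_cons, List.mem_cons, List.not_mem_nil, not_or] at h'
  set R := (formed (Function.update (ringProfile a b c d N) c S)).reach (· < ·) c with hR
  -- Each purchase is charged to at most one reached agent: its target off the cycle, or else `a`.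
  have hcover : ({b, c, d} : Finset V)ᶜ ⊆ Rᶜ.toFinset ∪ S.image fun p =>
      if p.1 ≠ a ∧ p.1 ≠ b ∧ p.1 ≠ c ∧ p.1 ≠ d then p.1 else a := by
    intro v hv
    simp only [Finset.mem_compl, Finset.mem_insert, Finset.mem_singleton, not_or] at hv
    rw [Finset.mem_union, Set.mem_toFinset, Finset.mem_image]
    by_cases hvR : v ∈ R
    · right
      by_cases hva : v = a
      · subst hva
        obtain ⟨p, hp, hne⟩ := exists_mem_of_mem_reach_c' h hN hS hvR
        exact ⟨p, hp, if_neg hne⟩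
      · obtain ⟨l, hl⟩ := exists_mem_of_mem_reach_c h hN hS ⟨hva, hv⟩ hvR
        exact ⟨(v, l), hl, if_pos ⟨hva, hv⟩⟩
    · exact Or.inl hvR
  have h1 := (Finset.card_le_card hcover).trans (Finset.card_union_le _ _)
  have h2 : (S.image fun p => if p.1 ≠ a ∧ p.1 ≠ b ∧ p.1 ≠ c ∧ p.1 ≠ d then p.1 else a).card
      ≤ S.card := Finset.card_image_le
  have h3 := Finset.card_add_card_compl ({b, c, d} : Finset V)
  have h4 : ({b, c, d} : Finset V).card ≤ 3 := Finset.card_le_three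
  rw [Set.ncard_eq_toFinset_card']
  omega

theorem isNash_ringProfile {K M : ℝ} (h : [a, b, c, d].Nodup) (hV : 4 ≤ Fintype.card V)
    (hK : 1 ≤ K) (hM : (Fintype.card V : ℝ) ≤ M) :
    IsNash (strictUniformCost K M) (ringProfile a b c d (Fintype.card V)) := by
  have hN : (1 : ℤ) < Fintype.card V := by omega
  have hM0 : 0 ≤ M := (Nat.cast_nonneg _).trans hM
  have hone : ∀ u ≠ c,
      strictUniformCost K M (ringProfile a b c d (Fintype.card V)) u ≤ 1 := fun u hu => by
    rw [strictUniformCost_ringProfile h hN, card_ringProfile hu, Nat.cast_one]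
  intro u S
  by_cases hc : u = c
  · subst hc
    have hcard : ((ringProfile a b u d (Fintype.card V) u).card : ℝ) + 3 = Fintype.card V := by
      exact_mod_cast card_ringProfile_c (N := (Fintype.card V : ℤ)) h
    rw [not_lt, strictUniformCost_ringProfile h hN, strictUniformCost_eq, Function.update_self]
    by_cases hS : ∀ p ∈ S, 1 ≤ p.2
    · have h1 : (Fintype.card V : ℝ) ≤ S.card + 3 + ((formed (Function.update
          (ringProfile a b u d (Fintype.card V)) u S)).reach (· < ·) u)ᶜ.ncard := by
        exact_mod_cast card_le_card_add_ncard_compl_reach h hN hS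
      have h2 := mul_nonneg hM0
        (Nat.cast_nonneg ((S.filter fun p => p.2 < 1).card) : (0 : ℝ) ≤ _)
      have h3 := mul_le_mul_of_nonneg_right hK (Nat.cast_nonneg (((formed (Function.update
          (ringProfile a b u d (Fintype.card V)) u S)).reach (· < ·) u)ᶜ.ncard) : (0 : ℝ) ≤ _)
      linarith
    · push Not at hS
      obtain ⟨p, hp, hp1⟩ := hS
      have h1 : (1 : ℝ) ≤ ((S.filter fun p => p.2 < 1).card : ℝ) := by
        exact_mod_cast Finset.card_pos.2 ⟨p, Finset.mem_filter.2 ⟨hp, hp1⟩⟩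
      -- A single penalty `M ≥ n` already exceeds the present cost `n - 3` of `c`.
      have h2 := mul_le_mul_of_nonneg_left h1 hM0
      have h3 := mul_nonneg (zero_le_one.trans hK) (Nat.cast_nonneg (((formed (Function.update
          (ringProfile a b u d (Fintype.card V)) u S)).reach (· < ·) u)ᶜ.ncard) : (0 : ℝ) ≤ _)
      have h4 : (0 : ℝ) ≤ S.card := Nat.cast_nonneg _
      linarith
  · refine (?_ : ∃ v, v ∉ _).elim fun v hv =>
      not_cost_update_lt (v := v) hK hM0 (hone u hc) hv S
    by_cases ha : u = a
    · subst ha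
      exact ⟨b, notMem_reach_update_a h⟩
    by_cases hb : u = b
    · subst hb
      exact ⟨c, notMem_reach_update_b h hN⟩
    by_cases hd : u = d
    · subst hd
      exact ⟨a, notMem_reach_update_d h hN⟩
    exact ⟨a, notMem_reach_update_of_ne h ⟨ha, hb, hc, hd⟩⟩

theorem sum_card_ringProfile (h : [a, b, c, d].Nodup) :
    ∑ u, (ringProfile a b c d N u).card + 4 = 2 * Fintype.card V := by
  have h1 := Finset.add_sum_erase Finset.univ (fun u => (ringProfile a b c d N u).card)
    (Finset.mem_univ c)
  rw [Finset.sum_congr rfl fun u hu => card_ringProfile (N := N) (Finset.ne_of_mem_erase hu)] at h1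
  rw [Finset.sum_const, smul_eq_mul, mul_one, Finset.card_erase_of_mem (Finset.mem_univ c),
    Finset.card_univ] at h1
  have := card_ringProfile_c (N := N) h
  omega

theorem socialCost_ringProfile {K M : ℝ} (h : [a, b, c, d].Nodup) (hN : 1 < N) :
    socialCost (strictUniformCost K M) (ringProfile a b c d N)
      = 2 * (Fintype.card V : ℝ) - 4 := by
  have h1 : (∑ u, ((ringProfile a b c d N u).card : ℝ)) + 4 = 2 * Fintype.card V := by
    exact_mod_cast sum_card_ringProfile (N := N) h
  rw [socialCost, Finset.sum_congr rfl fun u _ => strictUniformCost_ringProfile h hN u]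
  linarith

/-- The gossip bound and the number of purchases squeeze the count, so no check for doubly bought
edges is needed. -/
theorem ncard_edgeSet_ringProfile (h : [a, b, c, d].Nodup) (hN : 1 < N) :
    (formed (ringProfile a b c d N)).graph.edgeSet.ncard = 2 * Fintype.card V - 4 := by
  have h1 := (formed (ringProfile a b c d N)).two_mul_card_le
  have h2 := ncard_edgeSet_formed_le (ringProfile a b c d N)
  have h3 := sum_card_ringProfile (N := N) h
  simp only [temporallyConnected_ringProfile h hN _, Set.compl_univ, Set.ncard_empty,
    Finset.sum_const_zero] at h1
  omega

end CreationGame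

/-! ### Optimum and price of stability -/

theorem mainTheorem2 {V : Type*} [Fintype V] [DecidableEq V] (hV : 4 ≤ Fintype.card V)
    (K M : ℝ) (hK : 2 ≤ K) (hM : (Fintype.card V : ℝ) ≤ M) :
    (∃ s : CreationGame.Profile V,
      CreationGame.IsNash (CreationGame.strictUniformCost K M) s ∧
      CreationGame.IsRingProfile s ∧
      (CreationGame.formed s).TemporallyConnected (· < ·) ∧
      (CreationGame.formed s).graph.edgeSet.ncard = 2 * Fintype.card V - 4 ∧
      CreationGame.socialCost (CreationGame.strictUniformCost K M) s
        = 2 * (Fintype.card V : ℝ) - 4) ∧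
    IsLeast (Set.range
        (CreationGame.socialCost (V := V) (CreationGame.strictUniformCost K M)))
      (2 * (Fintype.card V : ℝ) - 4) ∧
    CreationGame.priceOfStability (V := V) (CreationGame.strictUniformCost K M) = 1 := by
  open CreationGame in
  obtain ⟨⟨e, he⟩⟩ : Nonempty (Fin 4 ↪ V) := Function.Embedding.nonempty_of_card_le (by simpa)
  have h : [e 0, e 1, e 2, e 3].Nodup := by simp [he.eq_iff]
  have hN : (1 : ℤ) < Fintype.card V := by omega
  have hK1 : 1 ≤ K := by linarith
  have hM0 : 0 ≤ M := (Nat.cast_nonneg _).trans hM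
  have hnash := isNash_ringProfile h hV hK1 hM
  have hcost := socialCost_ringProfile (K := K) (M := M) h hN
  have hlower := fun s : Profile V => two_mul_card_sub_le_socialCost hK1 hM0 s
  have hleast : IsLeast (Set.range (socialCost (V := V) (strictUniformCost K M)))
      (2 * (Fintype.card V : ℝ) - 4) :=
    ⟨⟨_, hcost⟩, by rintro _ ⟨s, rfl⟩; exact hlower s⟩
  have hleast' : IsLeast (socialCost (V := V) (strictUniformCost K M) ''
      {s | IsNash (strictUniformCost K M) s}) (2 * (Fintype.card V : ℝ) - 4) :=
    ⟨⟨_, hnash, hcost⟩, by rintro _ ⟨s, -, rfl⟩; exact hlower s⟩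
  refine ⟨⟨_, hnash, isRingProfile_ringProfile h hV, temporallyConnected_ringProfile h hN,
    ncard_edgeSet_ringProfile h hN, hcost⟩, hleast, ?_⟩
  -- Both infima are the same attained minimum, nonzero because `n ≥ 4`.
  rw [priceOfStability, hleast.csInf_eq, hleast'.csInf_eq, div_self]
  have : (4 : ℝ) ≤ Fintype.card V := by exact_mod_cast hV
  linarith
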